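/- Let $\mathcal H$ be a separable (possibly finite-dimensional) complex Hilbert space with orthonormal basis $(e_i)$, let $X$ be a locally compact Hausdorff space with Borel $\sigma$-algebra $\mathcal O(X)$, and let $\mathcal S(\mathcal H)$ be the set of density operators (positive operators of trace one). Let $\nu:\mathcal O(X)\to\mathcal B(\mathcal H)$ be a positive operator-valued measure, i.e. $\nu(E)\ge 0$ for all $E$, and for pairwise disjoint $E_k$ one has $\nu(\bigcup_{k}E_k)=\sum_k\nu(E_k)$ ultraweakly, that is, after applying $\operatorname{tr}(s\,\cdot)$ for every $s\in\mathcal S(\mathcal H)$. Let $\rho\in\mathcal S(\mathcal H)$ be of full rank (injective), and let $\nu_\rho(E)=\operatorname{tr}(\rho\,\nu(E))$, a finite positive measure. A quantum random variable is a function $f:X\to\mathcal B(\mathcal H)$ such that $x\mapsto\operatorname{tr}(sf(x))$ is Borel measurable for every $s\in\mathcal S(\mathcal H)$. Assume that the Radon–Nikodým derivative $D=\frac{d\nu}{d\nu_\rho}$, whose matrix entries are $\langle D e_j,e_i\rangle=\frac{d\nu_{ij}}{d\nu_\rho}$ with $\nu_{ij}(E)=\langle\nu(E)e_j,e_i\rangle$,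 is a quantum random variable with values in $\mathcal B(\mathcal H)$. Let $\mathcal L_{\mathcal H}(X,\nu)$ be the complex linear span of the positive quantum random variables. For $f\in\mathcal L_{\mathcal H}(X,\nu)$ and real $p,q\ge 1$ define, with values in $[0,\infty]$, \[ \|f\|_{S^p,L^q}=\sup_{s\in\mathcal S(\mathcal H)}\left(\int_X\left\|s^{1/2}D^{1/2}fD^{1/2}s^{1/2}\right\|_{S^p}^{q}\,d\nu_\rho\right)^{1/q},\qquad \|A\|_{S^p}=\operatorname{tr}(|A|^p)^{1/p}, \] \[ \|f\|_q=\inf\ \sup_{s\in\mathcal S(\mathcal H)}\left(\int_X \operatorname{tr}\!\left(sD^{1/2}(f_1+f_2+f_3+f_4)D^{1/2}\right)^q d\nu_\rho\right)^{1/q}, \] where the infimum is over all $f_1,f_2,f_3,f_4\in\mathcal L_{\mathcal H}(X,\nu)$ with $f_k\ge 0$ and $f=f_1-f_2+if_3-if_4$. Then: \begin{enumerate} \item for all real $p,q\ge1$, $\|\cdot\|_{S^p,L^q}$ is a seminorm on $\mathcal L_{\mathcal H}(X,\nu)$ with values in $[0,\infty]$: $\|0\|_{S^p,L^q}=0$,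 $\|\lambda f\|_{S^p,L^q}=|\lambda|\,\|f\|_{S^p,L^q}$ for $\lambda\in\mathbb C$ (with $0\cdot\infty=0$), and $\|f+g\|_{S^p,L^q}\le\|f\|_{S^p,L^q}+\|g\|_{S^p,L^q}$; \item $\|f\|_{S^p,L^q}\le\|f\|_{S^r,L^q}$ for all $f\in\mathcal L_{\mathcal H}(X,\nu)$ and all real $p\ge r\ge 1$, $q\ge1$; \item $\|f\|_{S^1,L^q}\le\|f\|_q$ for all $f\in\mathcal L_{\mathcal H}(X,\nu)$ and all real $q\ge 1$. \end{enumerate} -/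

import Mathlib

open MeasureTheory
open scoped ENNReal InnerProductSpace

namespace OpLp

noncomputable section

variable {ι : Type*} {H : Type*} [NormedAddCommGroup H] [InnerProductSpace ℂ H] [CompleteSpace H]

/-- The trace `∑ᵢ ⟨A eᵢ, eᵢ⟩` of a trace-class operator, computed in the orthonormal basis `e`. -/
def trace (e : HilbertBasis ι ℂ H) (A : H →L[ℂ] H) : ℂ :=
  ∑' i, ⟪e i, A (e i)⟫_ℂ

/-- The trace of a positive operator, with values in `[0, ∞]`. -/
def posTrace (e : HilbertBasis ι ℂ H) (A : H →L[ℂ] H) : ℝ≥0∞ :=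
  ∑' i, ENNReal.ofReal (⟪e i, A (e i)⟫_ℂ).re

/-- The density operators: positive operators of trace one. -/
def states (e : HilbertBasis ι ℂ H) : Set (H →L[ℂ] H) :=
  {s | 0 ≤ s ∧ posTrace e s = 1}

/-- The Schatten norm `tr(|A|^p)^{1/p}`, with values in `[0, ∞]`. -/
def schattenNorm (e : HilbertBasis ι ℂ H) (p : ℝ) (A : H →L[ℂ] H) : ℝ≥0∞ :=
  posTrace e ((CFC.abs A) ^ p) ^ (1 / p)

/-- The series `∑ₖ Aₖ` converges to `S` in the ultraweak topology, that is, after applying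
`tr(s ·)` for every density operator `s`. -/
def HasUltraweakSum (e : HilbertBasis ι ℂ H) (A : ℕ → H →L[ℂ] H) (S : H →L[ℂ] H) : Prop :=
  ∀ s ∈ states e, HasSum (fun k => trace e (s * A k)) (trace e (s * S))

/-- A positive operator-valued measure: an ultraweakly countably additive map from the measurable
sets to the positive operators (values at non-measurable sets are irrelevant). -/
structure POVM (X : Type*) [MeasurableSpace X] (e : HilbertBasis ι ℂ H) where
  /-- the value at a set -/
  toFun : Set X → H →L[ℂ] H
  nonneg : ∀ E, MeasurableSet E → 0 ≤ toFun E
  iUnion : ∀ E : ℕ → Set X, (∀ k, MeasurableSet (E k)) → Pairwise (Function.onFun Disjoint E) →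
    HasUltraweakSum e (fun k => toFun (E k)) (toFun (⋃ k, E k))

/-- For a density operator `s` and a positive operator `A` one has `0 ≤ tr(sA)`. -/
theorem trace_mul_re_nonneg (e : HilbertBasis ι ℂ H) {s A : H →L[ℂ] H} (hs : s ∈ states e)
    (hA : 0 ≤ A) : 0 ≤ (trace e (s * A)).re := by
  obtain ⟨hs0, hs1⟩ := hs
  set B : H →L[ℂ] H := CFC.sqrt s with hB
  have hBB : B * B = s := CFC.sqrt_mul_sqrt_self s hs0
  have hBpos : 0 ≤ B := CFC.sqrt_nonneg s
  have hBsymm : ∀ x y : H, ⟪B x, y⟫_ℂ = ⟪x, B y⟫_ℂ := fun x y =>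
    ((ContinuousLinearMap.nonneg_iff_isPositive B).1 hBpos).isSymmetric x y
  have hApos := (ContinuousLinearMap.nonneg_iff_isPositive A).1 hA
  have hAsymm : ∀ x y : H, ⟪A x, y⟫_ℂ = ⟪x, A y⟫_ℂ := fun x y => hApos.isSymmetric x y
  have parseval : ∀ x : H, HasSum (fun i => ‖⟪e i, x⟫_ℂ‖ ^ 2) (‖x‖ ^ 2) := by
    intro x
    have h := e.hasSum_inner_mul_inner x x
    have h2 := Complex.hasSum_re h
    have h3 : (⟪x, x⟫_ℂ).re = ‖x‖ ^ 2 := by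
      rw [inner_self_eq_norm_sq_to_K]; norm_cast
    rw [h3] at h2
    convert h2 using 2 with i
    rw [← inner_conj_symm x (e i), Complex.conj_mul']
    norm_cast
  have hBsum : Summable fun i => ‖B (e i)‖ ^ 2 := by
    have h1 : ∀ i, (⟪e i, s (e i)⟫_ℂ).re = ‖B (e i)‖ ^ 2 := by
      intro i
      rw [← hBB, mul_apply_eq_comp, ← hBsymm, inner_self_eq_norm_sq_to_K]
      norm_cast
    have h2 : ∑' i, ENNReal.ofReal (‖B (e i)‖ ^ 2) ≠ ∞ := by
      have : posTrace e s ≠ ∞ := by rw [hs1]; simp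
      simpa [posTrace, h1] using this
    have h3 := ENNReal.summable_toReal h2
    refine h3.congr fun i => ?_
    rw [ENNReal.toReal_ofReal (by positivity)]
  have hABsum : Summable fun i => ‖A (B (e i))‖ ^ 2 := by
    refine Summable.of_nonneg_of_le (fun i => by positivity) (fun i => ?_)
      (hBsum.mul_left (‖A‖ ^ 2))
    rw [← mul_pow]
    gcongr
    exact A.le_opNorm _
  have hP1 : Summable fun x : ι × ι => ‖⟪e x.2, B (e x.1)⟫_ℂ‖ ^ 2 := by
    rw [summable_prod_of_nonneg (fun x => by positivity)]
    refine ⟨fun i => (parseval (B (e i))).summable, ?_⟩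
    exact hBsum.congr fun i => (parseval (B (e i))).tsum_eq.symm
  have hP2 : Summable fun x : ι × ι => ‖⟪e x.1, A (B (e x.2))⟫_ℂ‖ ^ 2 := by
    have : Summable fun x : ι × ι => ‖⟪e x.2, A (B (e x.1))⟫_ℂ‖ ^ 2 := by
      rw [summable_prod_of_nonneg (fun x => by positivity)]
      refine ⟨fun i => (parseval (A (B (e i)))).summable, ?_⟩
      exact hABsum.congr fun i => (parseval (A (B (e i)))).tsum_eq.symm
    exact this.prod_symm
  have hswap : ∀ i j, ⟪e j, B (A (e i))⟫_ℂ = ⟪A (B (e j)), e i⟫_ℂ := by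
    intro i j
    rw [hAsymm, hBsymm]
  have hF : Summable (Function.uncurry
      fun i j : ι => ⟪B (e i), e j⟫_ℂ * ⟪e j, B (A (e i))⟫_ℂ) := by
    refine Summable.of_norm_bounded (hP1.add hP2) ?_
    rintro ⟨i, j⟩
    simp only [Function.uncurry, norm_mul]
    rw [hswap, norm_inner_symm (B (e i)), norm_inner_symm (A (B (e j)))]
    nlinarith [sq_nonneg (‖⟪e j, B (e i)⟫_ℂ‖ - ‖⟪e i, A (B (e j))⟫_ℂ‖),
      sq_nonneg (‖⟪e j, B (e i)⟫_ℂ‖), sq_nonneg ‖⟪e i, A (B (e j))⟫_ℂ‖]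
  have key : trace e (s * A) = ∑' j, ⟪A (B (e j)), B (e j)⟫_ℂ := by
    have h1 : ∀ i, ⟪e i, (s * A) (e i)⟫_ℂ = ∑' j, ⟪B (e i), e j⟫_ℂ * ⟪e j, B (A (e i))⟫_ℂ := by
      intro i
      rw [(e.hasSum_inner_mul_inner _ _).tsum_eq, hBsymm, ← hBB]
      rfl
    unfold trace
    rw [tsum_congr h1, ← hF.tsum_comm]
    refine tsum_congr fun j => ?_
    rw [← (e.hasSum_inner_mul_inner (A (B (e j))) (B (e j))).tsum_eq]
    refine tsum_congr fun i => ?_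
    rw [hswap, hBsymm, mul_comm]
  rw [key]
  by_cases hsum : Summable fun j => ⟪A (B (e j)), B (e j)⟫_ℂ
  · rw [Complex.re_tsum hsum]
    exact tsum_nonneg fun j => hApos.re_inner_nonneg_left (B (e j))
  · rw [tsum_eq_zero_of_not_summable hsum]; simp

variable {X : Type*} [MeasurableSpace X]

/-- The finite positive measure `ν_ρ(E) = tr(ρ ν(E))`. -/
def scalarMeasure {e : HilbertBasis ι ℂ H} (ν : POVM X e) {ρ : H →L[ℂ] H}
    (hρ : ρ ∈ states e) : Measure X :=
  Measure.ofMeasurable (fun E _ => ENNReal.ofReal (trace e (ρ * ν.toFun E)).re)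
    (by
      have h := ν.iUnion (fun _ => ∅) (fun _ => MeasurableSet.empty)
        (fun _ _ _ => disjoint_bot_left) ρ hρ
      have h0 := (summable_const_iff _).1 h.summable
      simp [h0])
    (by
      intro E hE hd
      have h := Complex.hasSum_re (ν.iUnion E hE hd ρ hρ)
      have hn : ∀ k, 0 ≤ (trace e (ρ * ν.toFun (E k))).re := fun k =>
        trace_mul_re_nonneg e hρ (ν.nonneg _ (hE k))
      rw [← h.tsum_eq, ENNReal.ofReal_tsum_of_nonneg hn h.summable])

/-- A quantum random variable: an operator-valued function `f` such that `x ↦ tr(s f(x))` is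
measurable for every density operator `s`. -/
def IsQuantumRV (e : HilbertBasis ι ℂ H) (f : X → H →L[ℂ] H) : Prop :=
  ∀ s ∈ states e, Measurable fun x => trace e (s * f x)

/-- The linear span of the positive quantum random variables. -/
def quantumSpan (X : Type*) [MeasurableSpace X] (e : HilbertBasis ι ℂ H) :
    Submodule ℂ (X → H →L[ℂ] H) :=
  Submodule.span ℂ {f | IsQuantumRV e f ∧ ∀ x, 0 ≤ f x}

/-- `D` is a (version of the) Radon–Nikodým derivative `dν/dν_ρ` with values in the bounded
operators: it is a quantum random variable, and its matrix entries in the basis `e` are the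
Radon–Nikodým derivatives of the complex measures `ν_{ij}(E) = ⟨ν(E) e_j, e_i⟩`. -/
structure IsRNDeriv {e : HilbertBasis ι ℂ H} (ν : POVM X e) {ρ : H →L[ℂ] H}
    (hρ : ρ ∈ states e) (D : X → H →L[ℂ] H) : Prop where
  isQuantumRV : IsQuantumRV e D
  integrable : ∀ i j, Integrable (fun x => ⟪e i, D x (e j)⟫_ℂ) (scalarMeasure ν hρ)
  setIntegral : ∀ i j E, MeasurableSet E →
    ⟪e i, ν.toFun E (e j)⟫_ℂ = ∫ x in E, ⟪e i, D x (e j)⟫_ℂ ∂(scalarMeasure ν hρ)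

/-- The function `x ↦ D(x)^{1/2} f(x) D(x)^{1/2}`. -/
def sandwich (D f : X → H →L[ℂ] H) (x : X) : H →L[ℂ] H :=
  CFC.sqrt (D x) * f x * CFC.sqrt (D x)

/-- `f_s(x) = tr(s D(x)^{1/2} f(x) D(x)^{1/2})`. -/
def stateFun (e : HilbertBasis ι ℂ H) (D : X → H →L[ℂ] H) (s : H →L[ℂ] H)
    (f : X → H →L[ℂ] H) (x : X) : ℂ :=
  trace e (s * sandwich D f x)

/-- The 4-tuples of positive elements of the span with `f = f₁ - f₂ + i f₃ - i f₄`. -/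
def posDecomp (e : HilbertBasis ι ℂ H) (f : X → H →L[ℂ] H) : Set (Fin 4 → X → H →L[ℂ] H) :=
  {g | (∀ k, g k ∈ quantumSpan X e ∧ ∀ x, 0 ≤ g k x) ∧
    f = g 0 - g 1 + Complex.I • g 2 - Complex.I • g 3}

/-- `‖f‖_q`: the infimum over the positive decompositions of `f` of
`sup_s ‖(f₁ + f₂ + f₃ + f₄)_s‖_{L^q(μ)}`. -/
def qNorm (e : HilbertBasis ι ℂ H) (μ : Measure X) (D : X → H →L[ℂ] H) (q : ℝ)
    (f : X → H →L[ℂ] H) : ℝ≥0∞ :=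
  ⨅ g ∈ posDecomp e f, ⨆ s ∈ states e,
    (∫⁻ x, ‖stateFun e D s (g 0 + g 1 + g 2 + g 3) x‖ₑ ^ q ∂μ) ^ (1 / q)

/-- `‖f‖_{S^p,L^q} = sup_s ‖ ‖s^{1/2} D^{1/2} f D^{1/2} s^{1/2}‖_{S^p} ‖_{L^q(μ)}`. -/
def schattenLNorm (e : HilbertBasis ι ℂ H) (μ : Measure X) (D : X → H →L[ℂ] H) (p q : ℝ)
    (f : X → H →L[ℂ] H) : ℝ≥0∞ :=
  ⨆ s ∈ states e,
    (∫⁻ x, schattenNorm e p (CFC.sqrt s * sandwich D f x * CFC.sqrt s) ^ q ∂μ) ^ (1 / q)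

/-- `N` restricts to a seminorm with values in `[0, ∞]` on the complex vector space `L`
(with the convention `0 · ∞ = 0`). -/
structure IsSeminormOn {V : Type*} [AddCommGroup V] [Module ℂ V] (L : Submodule ℂ V)
    (N : V → ℝ≥0∞) : Prop where
  map_zero : N 0 = 0
  smul : ∀ (c : ℂ), ∀ f ∈ L, N (c • f) = ‖c‖ₑ * N f
  add_le : ∀ f ∈ L, ∀ g ∈ L, N (f + g) ≤ N f + N g

end

end OpLp

/-! For a density operator `s` the operator `√s` is Hilbert–Schmidt, so every `√s A √s` is compact
and has a singular value decomposition. Its singular values compute the Schatten norms, which makes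
`‖·‖_{S^p}` decreasing in `p` because `ℓ^p` norms are. Expanding `⟨x, C y⟩` in singular vectors, the
AM-GM inequality and Jensen's inequality for doubly substochastic weights show that `‖C‖_{S^p}` is
the maximum of `(∑ₖ |⟨xₖ, C yₖ⟩|^p)^{1/p}` over pairs of Bessel families, so that the triangle
inequality for `S^p` is inherited from `ℓ^p`; the one for `‖·‖_{S^p,L^q}` follows by Minkowski's
inequality in `L^q`. Finally, `S^1` norm and trace agree on positive operators, so the triangle
inequality in `S^1` for `f = f₁ - f₂ + i f₃ - i f₄` gives the pointwise bound
`‖√s √D f √D √s‖_{S^1} ≤ tr(s √D (f₁ + f₂ + f₃ + f₄) √D)`. -/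

namespace OpLp

noncomputable section

open Filter Topology Polynomial

universe u v

section Inequalities

variable {ι κ : Type*}

theorem rpow_tsum_mul_le_tsum_mul_rpow {w : κ → ℝ≥0∞} (hw : ∑' k, w k ≤ 1) (a : κ → ℝ≥0∞)
    {p : ℝ} (hp : 1 ≤ p) : (∑' k, w k * a k) ^ p ≤ ∑' k, w k * a k ^ p := by
  have hp0 : 0 < p := one_pos.trans_le hp
  rw [← ENNReal.le_rpow_inv_iff hp0]
  refine ENNReal.summable.tsum_le_of_sum_le fun F => ?_
  calc ∑ k ∈ F, w k * a k
      ≤ (∑ k ∈ F, w k) ^ (1 - p⁻¹) * (∑ k ∈ F, w k * a k ^ p) ^ p⁻¹ :=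
        ENNReal.inner_le_weight_mul_Lp_of_nonneg F hp w a
    _ ≤ 1 * (∑' k, w k * a k ^ p) ^ p⁻¹ := by
        gcongr
        · exact ENNReal.rpow_le_one ((ENNReal.sum_le_tsum F).trans hw)
            (sub_nonneg.2 (inv_le_one_of_one_le₀ hp))
        · exact ENNReal.sum_le_tsum F
    _ = (∑' k, w k * a k ^ p) ^ p⁻¹ := one_mul _

theorem tsum_rpow_tsum_mul_le {c : ι → κ → ℝ≥0∞} (hrow : ∀ i, ∑' k, c i k ≤ 1)
    (hcol : ∀ k, ∑' i, c i k ≤ 1) (a : κ → ℝ≥0∞) {p : ℝ} (hp : 1 ≤ p) :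
    ∑' i, (∑' k, c i k * a k) ^ p ≤ ∑' k, a k ^ p :=
  calc ∑' i, (∑' k, c i k * a k) ^ p
      ≤ ∑' i, ∑' k, c i k * a k ^ p :=
        ENNReal.tsum_le_tsum fun i => rpow_tsum_mul_le_tsum_mul_rpow (hrow i) a hp
    _ = ∑' k, (∑' i, c i k) * a k ^ p := by
        rw [ENNReal.tsum_comm]
        simp_rw [ENNReal.tsum_mul_right]
    _ ≤ ∑' k, a k ^ p :=
        ENNReal.tsum_le_tsum fun k => mul_le_of_le_one_left zero_le (hcol k)

theorem rpow_tsum_add_rpow_le (a b : κ → ℝ≥0∞) {p : ℝ} (hp : 1 ≤ p) :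
    (∑' k, (a k + b k) ^ p) ^ (1 / p) ≤
      (∑' k, a k ^ p) ^ (1 / p) + (∑' k, b k ^ p) ^ (1 / p) := by
  let _ : MeasurableSpace κ := ⊤
  simpa only [lintegral_count, Pi.add_apply] using
    ENNReal.lintegral_Lp_add_le (μ := (Measure.count : Measure κ)) (f := a) (g := b)
      measurable_from_top.aemeasurable measurable_from_top.aemeasurable hp

theorem rpow_tsum_rpow_anti (a : κ → ℝ≥0∞) {p r : ℝ} (hr : 0 < r) (hrp : r ≤ p) :
    (∑' k, a k ^ p) ^ (1 / p) ≤ (∑' k, a k ^ r) ^ (1 / r) := by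
  have hp : 0 < p := hr.trans_le hrp
  set M := (∑' k, a k ^ r) ^ (1 / r) with hM
  have hMr : ∑' k, a k ^ r = M ^ r := by
    rw [hM, one_div, ENNReal.rpow_inv_rpow hr.ne']
  have haM (k : κ) : a k ≤ M := by
    rw [← ENNReal.rpow_le_rpow_iff hr, ← hMr]
    exact ENNReal.le_tsum k
  have hsplit (b : ℝ≥0∞) : b ^ p = b ^ (p - r) * b ^ r := by
    rw [← ENNReal.rpow_add_of_nonneg _ _ (sub_nonneg.2 hrp) hr.le, sub_add_cancel]
  rw [one_div, ENNReal.rpow_inv_le_iff hp]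
  calc ∑' k, a k ^ p = ∑' k, a k ^ (p - r) * a k ^ r := by simp_rw [hsplit]
    _ ≤ ∑' k, M ^ (p - r) * a k ^ r := by
        gcongr with k
        exact haM k
    _ = M ^ p := by rw [ENNReal.tsum_mul_left, hMr, ← hsplit]

theorem mul_le_inv_two_mul_sq_add_sq (a b : ℝ≥0∞) : a * b ≤ 2⁻¹ * (a ^ 2 + b ^ 2) := by
  simpa [mul_add, ENNReal.div_eq_inv_mul] using
    ENNReal.young_inequality a b Real.HolderConjugate.two_two

end Inequalities

section Bessel

variable {ι κ : Type*} {H : Type*} [NormedAddCommGroup H] [InnerProductSpace ℂ H]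

theorem enorm_inner_comm (x y : H) : ‖⟪x, y⟫_ℂ‖ₑ = ‖⟪y, x⟫_ℂ‖ₑ := by
  rw [← ofReal_norm, ← ofReal_norm, norm_inner_symm]

theorem enorm_inner_le_mul_enorm (x y : H) : ‖⟪x, y⟫_ℂ‖ₑ ≤ ‖x‖ₑ * ‖y‖ₑ := by
  simpa only [← ofReal_norm, ← ENNReal.ofReal_mul (norm_nonneg x)] using
    ENNReal.ofReal_le_ofReal (norm_inner_le_norm x y)

theorem tsum_enorm_inner_sq (e : HilbertBasis ι ℂ H) (z : H) :
    ∑' i, ‖⟪e i, z⟫_ℂ‖ₑ ^ 2 = ‖z‖ₑ ^ 2 := by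
  have hparseval : HasSum (fun i => ‖⟪e i, z⟫_ℂ‖ ^ 2) (‖z‖ ^ 2) := by
    convert Complex.hasSum_re (e.hasSum_inner_mul_inner z z) using 1
    · ext i
      rw [← inner_conj_symm z (e i), Complex.conj_mul']
      norm_cast
    · rw [inner_self_eq_norm_sq_to_K]
      norm_cast
  simpa only [ENNReal.ofReal_tsum_of_nonneg (fun _ => sq_nonneg _) hparseval.summable,
    ENNReal.ofReal_pow (norm_nonneg _), ofReal_norm] using congrArg ENNReal.ofReal hparseval.tsum_eq

/-- A Bessel family with Bessel bound `1`. Orthonormal families are Bessel, and unlike them Bessel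
families may contain the zero vector, which saves discarding the kernel in singular value
decompositions. -/
def IsBessel (x : κ → H) : Prop :=
  ∀ z, ∑' k, ‖⟪x k, z⟫_ℂ‖ₑ ^ 2 ≤ ‖z‖ₑ ^ 2

theorem isBessel_of_orthonormal {x : κ → H} (hx : Orthonormal ℂ x) : IsBessel x := by
  intro z
  have hbessel := ENNReal.ofReal_le_ofReal (hx.tsum_inner_products_le z)
  rw [ENNReal.ofReal_tsum_of_nonneg (fun _ => sq_nonneg _) (hx.inner_products_summable z)]
    at hbessel
  simpa only [ENNReal.ofReal_pow (norm_nonneg _), ofReal_norm] using hbessel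

theorem isBessel_normalize {y : κ → H} (hy : Pairwise fun j k => ⟪y j, y k⟫_ℂ = 0) :
    IsBessel fun k => NormedSpace.normalize (y k) := by
  have hortho : Orthonormal ℂ fun k : {k | y k ≠ 0} => NormedSpace.normalize (y k) := by
    refine ⟨fun k => NormedSpace.norm_normalize k.2, fun j k hjk => ?_⟩
    simp only [NormedSpace.normalize, inner_smul_left_eq_smul,
      inner_smul_right_eq_smul, hy (Subtype.coe_injective.ne hjk), smul_zero]
  intro z
  have hsupport : Function.support (fun k => ‖⟪NormedSpace.normalize (y k), z⟫_ℂ‖ₑ ^ 2) ⊆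
      {k | y k ≠ 0} := by
    intro k hk hyk
    simp [hyk] at hk
  exact (tsum_subtype_eq_of_support_subset hsupport).ge.trans (isBessel_of_orthonormal hortho z)

theorem enorm_inner_eq_enorm_inner_normalize_mul (x y : H) :
    ‖⟪x, y⟫_ℂ‖ₑ = ‖⟪NormedSpace.normalize y, x⟫_ℂ‖ₑ * ‖y‖ₑ := by
  conv_lhs => rw [← NormedSpace.norm_smul_normalize y]
  rw [enorm_inner_comm, inner_smul_left_eq_smul, enorm_smul, enorm_norm, mul_comm]

theorem enorm_inner_normalize_self (y : H) : ‖⟪NormedSpace.normalize y, y⟫_ℂ‖ₑ = ‖y‖ₑ := by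
  rcases eq_or_ne y 0 with rfl | hy
  · simp
  · rw [enorm_inner_eq_enorm_inner_normalize_mul, inner_self_eq_norm_sq_to_K,
      NormedSpace.norm_normalize hy]
    simp

theorem IsBessel.enorm_le_one {x : κ → H} (hx : IsBessel x) (k : κ) : ‖x k‖ₑ ≤ 1 := by
  have hsq : (‖x k‖ₑ ^ 2) ^ 2 ≤ ‖x k‖ₑ ^ 2 :=
    calc (‖x k‖ₑ ^ 2) ^ 2 = ‖⟪x k, x k⟫_ℂ‖ₑ ^ 2 := by
          rw [inner_self_eq_norm_sq_to_K, ← ofReal_norm (_ : ℂ), norm_pow, RCLike.norm_ofReal,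
            abs_norm, ENNReal.ofReal_pow (norm_nonneg _), ofReal_norm]
      _ ≤ ∑' j, ‖⟪x j, x k⟫_ℂ‖ₑ ^ 2 := ENNReal.le_tsum k
      _ ≤ ‖x k‖ₑ ^ 2 := hx (x k)
  by_contra! hlt
  have hlt_sq : 1 < ‖x k‖ₑ ^ 2 := one_lt_pow₀ hlt two_ne_zero
  have hne_top : ‖x k‖ₑ ^ 2 ≠ ∞ := ENNReal.pow_ne_top enorm_ne_top
  have hmul := ENNReal.mul_lt_mul_right (one_pos.trans hlt_sq).ne' hne_top hlt_sq
  rw [mul_one, ← sq] at hmul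
  exact absurd hsq hmul.not_ge

theorem IsBessel.tsum_inv_two_mul_le_one {u v : κ → H} (hu : IsBessel u) (hv : IsBessel v)
    {x y : H} (hx : ‖x‖ₑ ≤ 1) (hy : ‖y‖ₑ ≤ 1) :
    ∑' k, 2⁻¹ * (‖⟪u k, x⟫_ℂ‖ₑ ^ 2 + ‖⟪v k, y⟫_ℂ‖ₑ ^ 2) ≤ 1 := by
  rw [ENNReal.tsum_mul_left, ENNReal.tsum_add]
  calc 2⁻¹ * (∑' k, ‖⟪u k, x⟫_ℂ‖ₑ ^ 2 + ∑' k, ‖⟪v k, y⟫_ℂ‖ₑ ^ 2)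
      ≤ 2⁻¹ * (1 + 1) := by
        gcongr
        · exact (hu x).trans (pow_le_one' hx 2)
        · exact (hv y).trans (pow_le_one' hy 2)
    _ = 1 := by rw [one_add_one_eq_two, ENNReal.inv_mul_cancel two_ne_zero ENNReal.ofNat_ne_top]

end Bessel

section HilbertSchmidt

variable {ι κ : Type*} {H : Type*} [NormedAddCommGroup H] [InnerProductSpace ℂ H]

/-- The square of the Hilbert–Schmidt norm of `T`, computed in the orthonormal basis `e`. -/
def hsNormSq (e : HilbertBasis ι ℂ H) (T : H →L[ℂ] H) : ℝ≥0∞ :=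
  ∑' i, ‖T (e i)‖ₑ ^ 2

theorem hsNormSq_eq_tsum_tsum (e : HilbertBasis ι ℂ H) (f : HilbertBasis κ ℂ H) (T : H →L[ℂ] H) :
    hsNormSq e T = ∑' i, ∑' j, ‖⟪f j, T (e i)⟫_ℂ‖ₑ ^ 2 :=
  tsum_congr fun i => (tsum_enorm_inner_sq f (T (e i))).symm

theorem hsNormSq_mul_le (e : HilbertBasis ι ℂ H) (A T : H →L[ℂ] H) :
    hsNormSq e (A * T) ≤ ‖A‖ₑ ^ 2 * hsNormSq e T := by
  rw [hsNormSq, hsNormSq, ← ENNReal.tsum_mul_left]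
  refine ENNReal.tsum_le_tsum fun i => ?_
  rw [← mul_pow]
  gcongr
  exact A.le_opENorm (T (e i))

theorem isCompactOperator_rankOne (x y : H) :
    IsCompactOperator (InnerProductSpace.rankOne ℂ x y : H →L[ℂ] H) := by
  have hy : IsCompactOperator (innerSL ℂ y) :=
    isCompactOperator_of_locallyCompactSpace_dom (innerSL ℂ y)
  exact hy.clm_comp (ContinuousLinearMap.toSpanSingleton ℂ x)

theorem hsNormSq_sub_sum_rankOne (e : HilbertBasis ι ℂ H) (T : H →L[ℂ] H) (F : Finset ι) :
    hsNormSq e (T - ∑ i ∈ F, InnerProductSpace.rankOne ℂ (T (e i)) (e i)) =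
      ∑' j : {j // j ∉ F}, ‖T (e j)‖ₑ ^ 2 := by
  classical
  have happly (j : ι) : (T - ∑ i ∈ F, InnerProductSpace.rankOne ℂ (T (e i)) (e i)) (e j) =
      if j ∈ F then 0 else T (e j) := by
    simp only [sub_apply, sum_apply, InnerProductSpace.rankOne_apply,
      orthonormal_iff_ite.1 e.orthonormal, ite_smul, one_smul, zero_smul, Finset.sum_ite_eq']
    split_ifs <;> simp
  calc hsNormSq e (T - ∑ i ∈ F, InnerProductSpace.rankOne ℂ (T (e i)) (e i))
      = ∑' j, {j | j ∉ F}.indicator (fun j => ‖T (e j)‖ₑ ^ 2) j := by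
        refine tsum_congr fun j => ?_
        by_cases hj : j ∈ F <;> simp [happly, hj]
    _ = ∑' j : {j // j ∉ F}, ‖T (e j)‖ₑ ^ 2 := (tsum_subtype _ _).symm

variable [CompleteSpace H]

theorem hsNormSq_star (e : HilbertBasis ι ℂ H) (f : HilbertBasis κ ℂ H) (T : H →L[ℂ] H) :
    hsNormSq e (star T) = hsNormSq f T := by
  rw [hsNormSq_eq_tsum_tsum e f, hsNormSq_eq_tsum_tsum f e, ENNReal.tsum_comm]
  refine tsum_congr fun j => tsum_congr fun i => ?_
  rw [ContinuousLinearMap.star_eq_adjoint, ContinuousLinearMap.adjoint_inner_right,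
    enorm_inner_comm]

theorem hsNormSq_eq_hsNormSq (e : HilbertBasis ι ℂ H) (f : HilbertBasis κ ℂ H) (T : H →L[ℂ] H) :
    hsNormSq e T = hsNormSq f T := by
  rw [← hsNormSq_star f e, hsNormSq_star f f]

theorem enorm_apply_sq_le_hsNormSq_mul (e : HilbertBasis ι ℂ H) (T : H →L[ℂ] H) (x : H) :
    ‖T x‖ₑ ^ 2 ≤ hsNormSq e T * ‖x‖ₑ ^ 2 := by
  rw [← tsum_enorm_inner_sq e (T x), ← hsNormSq_star e e, hsNormSq, ← ENNReal.tsum_mul_right]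
  refine ENNReal.tsum_le_tsum fun i => ?_
  rw [← mul_pow, ← ContinuousLinearMap.adjoint_inner_left, ContinuousLinearMap.star_eq_adjoint]
  gcongr
  exact enorm_inner_le_mul_enorm _ _

theorem enorm_sq_le_hsNormSq (e : HilbertBasis ι ℂ H) (T : H →L[ℂ] H) :
    ‖T‖ₑ ^ 2 ≤ hsNormSq e T := by
  rcases eq_or_ne (hsNormSq e T) ∞ with htop | hfin
  · exact htop ▸ le_top
  have hbound : ‖T‖ ≤ √(hsNormSq e T).toReal := by
    refine T.opNorm_le_bound (Real.sqrt_nonneg _) fun x => ?_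
    have hx := ENNReal.toReal_mono (ENNReal.mul_ne_top hfin (ENNReal.pow_ne_top enorm_ne_top))
      (enorm_apply_sq_le_hsNormSq_mul e T x)
    simp only [ENNReal.toReal_mul, ENNReal.toReal_pow, toReal_enorm] at hx
    rw [← Real.sqrt_sq (norm_nonneg x), ← Real.sqrt_mul ENNReal.toReal_nonneg]
    exact Real.le_sqrt_of_sq_le hx
  rw [← ofReal_norm, ← ENNReal.ofReal_pow (norm_nonneg T), ENNReal.ofReal_le_iff_le_toReal hfin]
  exact (Real.le_sqrt (norm_nonneg T) ENNReal.toReal_nonneg).1 hbound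

theorem isCompactOperator_of_hsNormSq_ne_top (e : HilbertBasis ι ℂ H) {T : H →L[ℂ] H}
    (hT : hsNormSq e T ≠ ∞) : IsCompactOperator T := by
  let S (F : Finset ι) : H →L[ℂ] H := ∑ i ∈ F, InnerProductSpace.rankOne ℂ (T (e i)) (e i)
  have hS (F : Finset ι) : IsCompactOperator (S F) :=
    Submodule.sum_mem (compactOperator (RingHom.id ℂ) H H) fun i _ => isCompactOperator_rankOne _ _
  have hlim : Tendsto (fun F => ‖S F - T‖ₑ ^ 2) atTop (𝓝 0) := by
    refine tendsto_of_tendsto_of_tendsto_of_le_of_le tendsto_const_nhds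
      (ENNReal.tendsto_tsum_compl_atTop_zero hT) (fun _ => zero_le) fun F => ?_
    rw [enorm_sub_rev, ← hsNormSq_sub_sum_rankOne e T F]
    exact enorm_sq_le_hsNormSq e _
  refine isCompactOperator_of_tendsto (l := atTop) (F := S) ?_ (.of_forall hS)
  rw [tendsto_iff_edist_tendsto_0]
  simpa [edist_eq_enorm_sub, ← ENNReal.rpow_natCast_mul] using hlim.ennrpow_const 2⁻¹

theorem trace_mul_comm_of_hsNormSq_ne_top (e : HilbertBasis ι ℂ H) {S T : H →L[ℂ] H}
    (hS : hsNormSq e S ≠ ∞) (hT : hsNormSq e T ≠ ∞) : trace e (S * T) = trace e (T * S) := by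
  let a (i j : ι) : ℂ := ⟪e i, S (e j)⟫_ℂ * ⟪e j, T (e i)⟫_ℂ
  have hsum : Summable (Function.uncurry a) := by
    refine .of_enorm (ne_top_of_le_ne_top (ENNReal.mul_ne_top (by simp : (2⁻¹ : ℝ≥0∞) ≠ ∞)
      (ENNReal.add_ne_top.2 ⟨hS, hT⟩)) ?_)
    calc ∑' x : ι × ι, ‖Function.uncurry a x‖ₑ
        = ∑' i, ∑' j, ‖⟪e i, S (e j)⟫_ℂ‖ₑ * ‖⟪e j, T (e i)⟫_ℂ‖ₑ := by
          simp_rw [← enorm_mul]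
          exact ENNReal.tsum_prod'
      _ ≤ ∑' i, ∑' j, 2⁻¹ * (‖⟪e i, S (e j)⟫_ℂ‖ₑ ^ 2 + ‖⟪e j, T (e i)⟫_ℂ‖ₑ ^ 2) := by
          refine ENNReal.tsum_le_tsum fun i => ENNReal.tsum_le_tsum fun j => ?_
          exact mul_le_inv_two_mul_sq_add_sq _ _
      _ = 2⁻¹ * (hsNormSq e S + hsNormSq e T) := by
          simp_rw [ENNReal.tsum_mul_left, ENNReal.tsum_add]
          rw [hsNormSq_eq_tsum_tsum e e S, hsNormSq_eq_tsum_tsum e e T, ENNReal.tsum_comm]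
  have hentry (A B : H →L[ℂ] H) (i : ι) :
      ∑' j, ⟪e i, A (e j)⟫_ℂ * ⟪e j, B (e i)⟫_ℂ = ⟪e i, (A * B) (e i)⟫_ℂ := by
    simp_rw [← ContinuousLinearMap.adjoint_inner_left A]
    exact (e.tsum_inner_mul_inner _ _).trans (A.adjoint_inner_left _ _)
  calc trace e (S * T) = ∑' i, ∑' j, a i j := (tsum_congr (hentry S T)).symm
    _ = ∑' j, ∑' i, a i j := hsum.tsum_comm.symm
    _ = trace e (T * S) := tsum_congr fun j => by
        rw [← hentry T S]
        exact tsum_congr fun i => mul_comm _ _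

end HilbertSchmidt

section Trace

variable {ι κ : Type*} {H : Type*} [NormedAddCommGroup H] [InnerProductSpace ℂ H]

theorem posTrace_sum {α : Type*} (e : HilbertBasis ι ℂ H) (s : Finset α) {P : α → H →L[ℂ] H}
    (hP : ∀ k ∈ s, 0 ≤ P k) : posTrace e (∑ k ∈ s, P k) = ∑ k ∈ s, posTrace e (P k) := by
  unfold posTrace
  rw [← Summable.tsum_finsetSum fun _ _ => ENNReal.summable]
  refine tsum_congr fun i => ?_
  rw [sum_apply, inner_sum, Complex.re_sum, ENNReal.ofReal_sum_of_nonneg fun k hk => ?_]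
  exact ((ContinuousLinearMap.nonneg_iff_isPositive _).1 (hP k hk)).re_inner_nonneg_right (e i)

theorem posTrace_smul (e : HilbertBasis ι ℂ H) {c : ℝ} (hc : 0 ≤ c) (A : H →L[ℂ] H) :
    posTrace e (c • A) = ENNReal.ofReal c * posTrace e A := by
  unfold posTrace
  rw [← ENNReal.tsum_mul_left]
  refine tsum_congr fun i => ?_
  rw [← ENNReal.ofReal_mul hc, ← Complex.coe_smul, smul_apply, inner_smul_right,
    Complex.re_ofReal_mul]

theorem trace_eq_toReal_posTrace (e : HilbertBasis ι ℂ H) {P : H →L[ℂ] H} (hP : 0 ≤ P) :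
    trace e P = (posTrace e P).toReal := by
  have hpos := (ContinuousLinearMap.nonneg_iff_isPositive P).1 hP
  rw [posTrace, ENNReal.tsum_toReal_eq fun _ => ENNReal.ofReal_ne_top, Complex.ofReal_tsum]
  refine tsum_congr fun i => ?_
  have hre : 0 ≤ (⟪e i, P (e i)⟫_ℂ).re := hpos.re_inner_nonneg_right (e i)
  rw [ENNReal.toReal_ofReal hre]
  exact (Complex.conj_eq_iff_re.1 (by
    rw [inner_conj_symm]; exact hpos.isSymmetric (e i) (e i))).symm

variable [CompleteSpace H]

theorem posTrace_star_mul_self (e : HilbertBasis ι ℂ H) (T : H →L[ℂ] H) :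
    posTrace e (star T * T) = hsNormSq e T := by
  refine tsum_congr fun i => ?_
  rw [mul_apply_eq_comp, ContinuousLinearMap.star_eq_adjoint,
    ContinuousLinearMap.adjoint_inner_right, ← ofReal_norm, ← ENNReal.ofReal_pow (norm_nonneg _)]
  exact congrArg ENNReal.ofReal (inner_self_eq_norm_sq (𝕜 := ℂ) _)

theorem star_sqrt_mul_sqrt {P : H →L[ℂ] H} (hP : 0 ≤ P) : star (CFC.sqrt P) * CFC.sqrt P = P := by
  rw [(CFC.sqrt_nonneg P).star_eq, CFC.sqrt_mul_sqrt_self P hP]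

theorem posTrace_eq_hsNormSq_sqrt (e : HilbertBasis ι ℂ H) {P : H →L[ℂ] H} (hP : 0 ≤ P) :
    posTrace e P = hsNormSq e (CFC.sqrt P) := by
  rw [← posTrace_star_mul_self, star_sqrt_mul_sqrt hP]

theorem posTrace_eq_posTrace (e : HilbertBasis ι ℂ H) (f : HilbertBasis κ ℂ H) {P : H →L[ℂ] H}
    (hP : 0 ≤ P) : posTrace e P = posTrace f P := by
  rw [posTrace_eq_hsNormSq_sqrt e hP, posTrace_eq_hsNormSq_sqrt f hP, hsNormSq_eq_hsNormSq e f]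

theorem sqrt_conj_nonneg (s : H →L[ℂ] H) {A : H →L[ℂ] H} (hA : 0 ≤ A) :
    0 ≤ CFC.sqrt s * A * CFC.sqrt s := by
  simpa only [(CFC.sqrt_nonneg s).star_eq] using star_left_conjugate_nonneg hA (CFC.sqrt s)

theorem hsNormSq_sqrt_of_mem_states {e : HilbertBasis ι ℂ H} {s : H →L[ℂ] H} (hs : s ∈ states e) :
    hsNormSq e (CFC.sqrt s) = 1 := by
  rw [← posTrace_eq_hsNormSq_sqrt e hs.1, hs.2]

theorem hsNormSq_mul_sqrt_ne_top {e : HilbertBasis ι ℂ H} {s : H →L[ℂ] H} (hs : s ∈ states e)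
    (A : H →L[ℂ] H) : hsNormSq e (A * CFC.sqrt s) ≠ ∞ := by
  refine ne_top_of_le_ne_top ?_ (hsNormSq_mul_le e A (CFC.sqrt s))
  rw [hsNormSq_sqrt_of_mem_states hs, mul_one]
  exact ENNReal.pow_ne_top enorm_ne_top

theorem isCompactOperator_sqrt_conj {e : HilbertBasis ι ℂ H} {s : H →L[ℂ] H} (hs : s ∈ states e)
    (A : H →L[ℂ] H) : IsCompactOperator (CFC.sqrt s * A * CFC.sqrt s : H →L[ℂ] H) :=
  isCompactOperator_of_hsNormSq_ne_top e (hsNormSq_mul_sqrt_ne_top hs (CFC.sqrt s * A))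

theorem trace_mul_eq_trace_sqrt_conj {e : HilbertBasis ι ℂ H} {s : H →L[ℂ] H} (hs : s ∈ states e)
    (A : H →L[ℂ] H) : trace e (s * A) = trace e (CFC.sqrt s * A * CFC.sqrt s) := by
  have hsqrt : hsNormSq e (CFC.sqrt s) ≠ ∞ := by
    rw [hsNormSq_sqrt_of_mem_states hs]
    exact ENNReal.one_ne_top
  have hsqrt_mul : hsNormSq e (CFC.sqrt s * A) ≠ ∞ := by
    rw [← hsNormSq_star e e, star_mul, (CFC.sqrt_nonneg s).star_eq]
    exact hsNormSq_mul_sqrt_ne_top hs (star A)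
  rw [← trace_mul_comm_of_hsNormSq_ne_top e hsqrt hsqrt_mul, ← mul_assoc,
    CFC.sqrt_mul_sqrt_self s hs.1]

theorem enorm_trace_mul_of_nonneg {e : HilbertBasis ι ℂ H} {s A : H →L[ℂ] H} (hs : s ∈ states e)
    (hA : 0 ≤ A) : ‖trace e (s * A)‖ₑ = posTrace e (CFC.sqrt s * A * CFC.sqrt s) := by
  have hfactor : CFC.sqrt s * A * CFC.sqrt s =
      star (CFC.sqrt A * CFC.sqrt s) * (CFC.sqrt A * CFC.sqrt s) := by
    conv_lhs => rw [← star_sqrt_mul_sqrt hA]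
    rw [star_mul, (CFC.sqrt_nonneg s).star_eq]
    simp only [mul_assoc]
  have hfin : posTrace e (CFC.sqrt s * A * CFC.sqrt s) ≠ ∞ := by
    rw [hfactor, posTrace_star_mul_self]
    exact hsNormSq_mul_sqrt_ne_top hs (CFC.sqrt A)
  rw [trace_mul_eq_trace_sqrt_conj hs, trace_eq_toReal_posTrace e (sqrt_conj_nonneg s hA),
    ← ofReal_norm, Complex.norm_of_nonneg ENNReal.toReal_nonneg, ENNReal.ofReal_toReal hfin]

end Trace

section Spectral

variable {A : Type*} [CStarAlgebra A]

theorem exists_polynomial_tendstoLocallyUniformly {f : ℝ → ℝ} (hf : Continuous f) :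
    ∃ P : ℕ → ℝ[X], TendstoLocallyUniformly (fun n x => (P n).eval x) f atTop := by
  have hnear (n : ℕ) :
      ∃ p : ℝ[X], ∀ x ∈ Set.Icc (-(n : ℝ)) n, |p.eval x - f x| < 1 / ((n : ℝ) + 1) :=
    exists_polynomial_near_of_continuousOn _ _ f hf.continuousOn _ (by positivity)
  choose P hP using hnear
  refine ⟨P, tendstoLocallyUniformly_iff_forall_isCompact.2 fun K hK => ?_⟩
  rw [Metric.tendstoUniformlyOn_iff]
  intro ε hε
  obtain ⟨R, hR⟩ := hK.isBounded.exists_norm_le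
  have hsmall := tendsto_one_div_add_atTop_nhds_zero_nat (𝕜 := ℝ)
  filter_upwards [hsmall.eventually (gt_mem_nhds hε),
    tendsto_natCast_atTop_atTop.eventually_ge_atTop R] with n hnε hnR x hx
  rw [dist_comm, Real.dist_eq]
  exact (hP n x (abs_le.1 ((hR x hx).trans hnR))).trans hnε

theorem tendsto_aeval_cfc {P : ℕ → ℝ[X]} {f : ℝ → ℝ}
    (hP : TendstoLocallyUniformly (fun n x => (P n).eval x) f atTop) {a : A}
    (ha : IsSelfAdjoint a) : Tendsto (fun n => aeval a (P n)) atTop (𝓝 (cfc f a)) := by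
  simp_rw [← cfc_polynomial (P _) a ha]
  exact tendsto_cfc_fun
    (tendstoLocallyUniformly_iff_forall_isCompact.1 hP _
      (ContinuousFunctionalCalculus.isCompact_spectrum a))
    (.of_forall fun n => (P n).continuous.continuousOn)

variable {H : Type*} [NormedAddCommGroup H] [InnerProductSpace ℂ H]

theorem aeval_apply_of_apply_eq_smul {a : H →L[ℂ] H} {l : ℝ} {v : H} (hv : a v = (l : ℂ) • v)
    (p : ℝ[X]) : aeval a p v = ((p.eval l : ℝ) : ℂ) • v := by
  have hpow (n : ℕ) : (a ^ n) v = ((l ^ n : ℝ) : ℂ) • v := by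
    induction n with
    | zero => simp
    | succ n ih =>
      rw [pow_succ, mul_apply_eq_comp, hv, map_smul, ih, smul_smul, ← Complex.ofReal_mul,
        pow_succ']
  induction p using Polynomial.induction_on' with
  | add p q hp hq => simp [hp, hq, add_smul]
  | monomial n c =>
    rw [aeval_monomial, Algebra.algebraMap_eq_smul_one, smul_mul_assoc, one_mul,
      ← Complex.coe_smul, smul_apply, hpow, eval_monomial, smul_smul, ← Complex.ofReal_mul]

variable [CompleteSpace H]

theorem cfc_apply_of_apply_eq_smul {a : H →L[ℂ] H} (ha : IsSelfAdjoint a) {f : ℝ → ℝ}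
    (hf : Continuous f) {l : ℝ} {v : H} (hv : a v = (l : ℂ) • v) :
    cfc f a v = (f l : ℂ) • v := by
  obtain ⟨P, hP⟩ := exists_polynomial_tendstoLocallyUniformly hf
  have hcfc : Tendsto (fun n => aeval a (P n) v) atTop (𝓝 (cfc f a v)) :=
    ((continuous_eval_const v).tendsto _).comp (tendsto_aeval_cfc hP ha)
  have heval : Tendsto (fun n => (((P n).eval l : ℝ) : ℂ) • v) atTop (𝓝 ((f l : ℂ) • v)) :=
    ((Complex.continuous_ofReal.tendsto _).comp ((tendstoLocallyUniformlyOn_univ.2 hP).tendsto_at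
      (Set.mem_univ l))).smul_const v
  simp_rw [← aeval_apply_of_apply_eq_smul hv] at heval
  exact tendsto_nhds_unique hcfc heval

theorem exists_hilbertBasis_forall_mem {H : Type u} [NormedAddCommGroup H]
    [InnerProductSpace ℂ H] [CompleteSpace H] {α : Type v} {V : α → Submodule ℂ H}
    [∀ a, CompleteSpace (V a)] (hV : OrthogonalFamily ℂ (fun a => V a) fun a => (V a).subtypeₗᵢ)
    (hbot : (⨆ a, V a)ᗮ = ⊥) :
    ∃ (κ : Type (max u v)) (b : HilbertBasis κ ℂ H) (g : κ → α), ∀ k, b k ∈ V (g k) := by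
  choose w b _ using fun a => exists_hilbertBasis ℂ (V a)
  have hb : Orthonormal ℂ fun k : Σ a, w a => (b k.1 k.2 : H) :=
    hV.orthonormal_sigma_orthonormal fun a => (b a).orthonormal
  have hspan : (Submodule.span ℂ (Set.range fun k : Σ a, w a => (b k.1 k.2 : H)))ᗮ = ⊥ := by
    rw [eq_bot_iff, ← hbot, ← Submodule.iInf_orthogonal]
    intro x hx
    simp only [Submodule.mem_iInf, Submodule.mem_orthogonal'] at hx ⊢
    intro a y hy
    have hsum := ((b a).hasSum_repr ⟨y, hy⟩).mapL ((innerSL ℂ x).comp (V a).subtypeL)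
    refine hsum.unique ?_
    convert hasSum_zero with i
    simp [hx (b a i) (Submodule.subset_span ⟨⟨a, i⟩, rfl⟩)]
  refine ⟨Σ a, w a, HilbertBasis.mkOfOrthogonalEqBot hb hspan, Sigma.fst, fun k => ?_⟩
  rw [HilbertBasis.coe_mkOfOrthogonalEqBot]
  exact (b k.1 k.2).2

theorem exists_hilbertBasis_apply_eq_smul {H : Type u} [NormedAddCommGroup H]
    [InnerProductSpace ℂ H] [CompleteSpace H] {T : H →L[ℂ] H} (hT : IsSelfAdjoint T)
    (hc : IsCompactOperator T) :
    ∃ (κ : Type u) (b : HilbertBasis κ ℂ H) (m : κ → ℂ), ∀ k, T (b k) = m k • b k := by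
  have hsymm : (T : Module.End ℂ H).IsSymmetric := hT.isSymmetric
  have (m : ℂ) : CompleteSpace (Module.End.eigenspace (T : Module.End ℂ H) m) :=
    (T.isClosed_eigenspace m).completeSpace_coe
  obtain ⟨κ, b, m, hm⟩ := exists_hilbertBasis_forall_mem hsymm.orthogonalFamily_eigenspaces
    (ContinuousLinearMap.orthogonalComplement_iSup_eigenspaces_eq_bot hc hsymm)
  exact ⟨κ, b, m, fun k => Module.End.mem_eigenspace_iff.1 (hm k)⟩

end Spectral

section SingularValues

variable {ι κ : Type*} {H : Type u} [NormedAddCommGroup H] [InnerProductSpace ℂ H]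

theorem enorm_inner_apply_le_tsum (C : H →L[ℂ] H) (w : HilbertBasis κ ℂ H) (x y : H) :
    ‖⟪x, C y⟫_ℂ‖ₑ ≤ ∑' k,
      2⁻¹ * (‖⟪NormedSpace.normalize (C (w k)), x⟫_ℂ‖ₑ ^ 2 + ‖⟪w k, y⟫_ℂ‖ₑ ^ 2) *
        ‖C (w k)‖ₑ := by
  have hexpand : HasSum (fun k => ⟪x, C (w k)⟫_ℂ * ⟪w k, y⟫_ℂ) ⟪x, C y⟫_ℂ := by
    simpa [w.repr_apply_apply, mul_comm] using (w.hasSum_repr y).mapL ((innerSL ℂ x).comp C)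
  rw [← hexpand.tsum_eq]
  refine enorm_tsum_le_tsum_enorm.trans (ENNReal.tsum_le_tsum fun k => ?_)
  rw [enorm_mul, enorm_inner_eq_enorm_inner_normalize_mul x, mul_right_comm]
  gcongr ?_ * _
  exact mul_le_inv_two_mul_sq_add_sq _ _

/-- `w` consists of right singular vectors of `C`: the images `C (w k)` are pairwise orthogonal. The
singular values are then the norms `‖C (w k)‖`, and the left singular vectors are the normalized
images. Zero singular values are allowed. -/
def IsSingularBasis (C : H →L[ℂ] H) (w : HilbertBasis κ ℂ H) : Prop :=
  Pairwise fun j k => ⟪C (w j), C (w k)⟫_ℂ = 0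

namespace IsSingularBasis

variable {C : H →L[ℂ] H} {w : HilbertBasis κ ℂ H}

theorem isBessel_left (hw : IsSingularBasis C w) :
    IsBessel fun k => NormedSpace.normalize (C (w k)) :=
  isBessel_normalize hw

variable [CompleteSpace H]

theorem star_mul_self_apply (hw : IsSingularBasis C w) (k : κ) :
    (star C * C) (w k) = ((‖C (w k)‖ ^ 2 : ℝ) : ℂ) • w k := by
  classical
  refine w.repr.injective ?_
  ext j
  rw [map_smul, lp.coeFn_smul, Pi.smul_apply, w.repr_apply_apply, w.repr_apply_apply,
    orthonormal_iff_ite.1 w.orthonormal, mul_apply_eq_comp, ContinuousLinearMap.star_eq_adjoint,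
    ContinuousLinearMap.adjoint_inner_right]
  split_ifs with hjk
  · subst hjk
    simp [inner_self_eq_norm_sq_to_K]
  · rw [hw hjk, smul_zero]

theorem abs_apply (hw : IsSingularBasis C w) (k : κ) :
    CFC.abs C (w k) = (‖C (w k)‖ : ℂ) • w k := by
  have hnonneg : 0 ≤ star C * C := star_mul_self_nonneg C
  rw [CFC.abs, CFC.sqrt_eq_real_sqrt _ hnonneg, cfcₙ_eq_cfc,
    cfc_apply_of_apply_eq_smul hnonneg.isSelfAdjoint Real.continuous_sqrt
      (hw.star_mul_self_apply k), Real.sqrt_sq (norm_nonneg _)]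

theorem abs_rpow_apply (hw : IsSingularBasis C w) {p : ℝ} (hp : 0 ≤ p) (k : κ) :
    (CFC.abs C ^ p) (w k) = ((‖C (w k)‖ ^ p : ℝ) : ℂ) • w k := by
  rw [CFC.rpow_eq_cfc_real (ha := CFC.abs_nonneg C)]
  exact cfc_apply_of_apply_eq_smul (CFC.abs_nonneg C).isSelfAdjoint
    (Real.continuous_rpow_const hp) (hw.abs_apply k)

theorem schattenNorm_eq (hw : IsSingularBasis C w) (e : HilbertBasis ι ℂ H) {p : ℝ} (hp : 0 ≤ p) :
    schattenNorm e p C = (∑' k, ‖C (w k)‖ₑ ^ p) ^ (1 / p) := by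
  rw [schattenNorm, posTrace_eq_posTrace e w CFC.rpow_nonneg, posTrace]
  congr 1
  refine tsum_congr fun k => ?_
  rw [hw.abs_rpow_apply hp, inner_smul_right, inner_self_eq_norm_sq_to_K, w.orthonormal.1,
    ← ofReal_norm, ENNReal.ofReal_rpow_of_nonneg (norm_nonneg _) hp]
  simp

end IsSingularBasis

variable [CompleteSpace H]

theorem exists_isSingularBasis {C : H →L[ℂ] H} (hC : IsCompactOperator C) :
    ∃ (κ : Type u) (w : HilbertBasis κ ℂ H), IsSingularBasis C w := by
  obtain ⟨κ, w, m, hw⟩ := exists_hilbertBasis_apply_eq_smul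
    (star_mul_self_nonneg C).isSelfAdjoint (hC.clm_comp (star C))
  refine ⟨κ, w, fun j k hjk => ?_⟩
  beta_reduce
  rw [← ContinuousLinearMap.adjoint_inner_right, ← ContinuousLinearMap.star_eq_adjoint,
    ← mul_apply_eq_comp, hw, inner_smul_right, w.orthonormal.2 hjk, mul_zero]

theorem rpow_tsum_enorm_inner_le_schattenNorm (e : HilbertBasis ι ℂ H) {C : H →L[ℂ] H}
    (hC : IsCompactOperator C) {x y : κ → H} (hx : IsBessel x) (hy : IsBessel y) {p : ℝ}
    (hp : 1 ≤ p) : (∑' i, ‖⟪x i, C (y i)⟫_ℂ‖ₑ ^ p) ^ (1 / p) ≤ schattenNorm e p C := by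
  obtain ⟨_, w, hw⟩ := exists_isSingularBasis hC
  have hp0 : 0 ≤ p := zero_le_one.trans hp
  rw [hw.schattenNorm_eq e hp0]
  gcongr
  calc ∑' i, ‖⟪x i, C (y i)⟫_ℂ‖ₑ ^ p
      ≤ ∑' i, (∑' k, 2⁻¹ * (‖⟪NormedSpace.normalize (C (w k)), x i⟫_ℂ‖ₑ ^ 2 +
          ‖⟪w k, y i⟫_ℂ‖ₑ ^ 2) * ‖C (w k)‖ₑ) ^ p := by
        gcongr with i
        exact enorm_inner_apply_le_tsum C w (x i) (y i)
    _ ≤ ∑' k, ‖C (w k)‖ₑ ^ p := by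
        refine tsum_rpow_tsum_mul_le (fun i => ?_) (fun k => ?_) _ hp
        · exact hw.isBessel_left.tsum_inv_two_mul_le_one (isBessel_of_orthonormal w.orthonormal)
            (hx.enorm_le_one i) (hy.enorm_le_one i)
        · simp only [enorm_inner_comm (NormedSpace.normalize _), enorm_inner_comm (w k)]
          exact hx.tsum_inv_two_mul_le_one hy (hw.isBessel_left.enorm_le_one k)
            ((isBessel_of_orthonormal w.orthonormal).enorm_le_one k)

theorem exists_isBessel_schattenNorm_eq (e : HilbertBasis ι ℂ H) {C : H →L[ℂ] H}
    (hC : IsCompactOperator C) : ∃ (κ : Type u) (x y : κ → H), IsBessel x ∧ IsBessel y ∧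
      ∀ p, 0 ≤ p → schattenNorm e p C = (∑' k, ‖⟪x k, C (y k)⟫_ℂ‖ₑ ^ p) ^ (1 / p) := by
  obtain ⟨κ, w, hw⟩ := exists_isSingularBasis hC
  refine ⟨κ, fun k => NormedSpace.normalize (C (w k)), w, hw.isBessel_left,
    isBessel_of_orthonormal w.orthonormal, fun p hp => ?_⟩
  simp_rw [hw.schattenNorm_eq e hp, enorm_inner_normalize_self]

theorem schattenNorm_add_le (e : HilbertBasis ι ℂ H) {A B : H →L[ℂ] H} (hA : IsCompactOperator A)
    (hB : IsCompactOperator B) {p : ℝ} (hp : 1 ≤ p) :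
    schattenNorm e p (A + B) ≤ schattenNorm e p A + schattenNorm e p B := by
  obtain ⟨_, x, y, hx, hy, hnorm⟩ := exists_isBessel_schattenNorm_eq (C := A + B) e (hA.add hB)
  have hp0 : 0 ≤ p := zero_le_one.trans hp
  calc schattenNorm e p (A + B)
      = (∑' k, ‖⟪x k, A (y k)⟫_ℂ + ⟪x k, B (y k)⟫_ℂ‖ₑ ^ p) ^ (1 / p) := by
        simp_rw [hnorm p hp0, add_apply, inner_add_right]
    _ ≤ (∑' k, (‖⟪x k, A (y k)⟫_ℂ‖ₑ + ‖⟪x k, B (y k)⟫_ℂ‖ₑ) ^ p) ^ (1 / p) := by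
        gcongr
        exact enorm_add_le _ _
    _ ≤ (∑' k, ‖⟪x k, A (y k)⟫_ℂ‖ₑ ^ p) ^ (1 / p) + (∑' k, ‖⟪x k, B (y k)⟫_ℂ‖ₑ ^ p) ^ (1 / p) :=
        rpow_tsum_add_rpow_le _ _ hp
    _ ≤ schattenNorm e p A + schattenNorm e p B :=
        add_le_add (rpow_tsum_enorm_inner_le_schattenNorm e hA hx hy hp)
          (rpow_tsum_enorm_inner_le_schattenNorm e hB hx hy hp)

theorem schattenNorm_anti (e : HilbertBasis ι ℂ H) {C : H →L[ℂ] H} (hC : IsCompactOperator C)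
    {p r : ℝ} (hr : 0 < r) (hrp : r ≤ p) : schattenNorm e p C ≤ schattenNorm e r C := by
  obtain ⟨_, w, hw⟩ := exists_isSingularBasis hC
  rw [hw.schattenNorm_eq e hr.le, hw.schattenNorm_eq e (hr.le.trans hrp)]
  exact rpow_tsum_rpow_anti _ hr hrp

theorem smul_rpow_of_nonneg {P : H →L[ℂ] H} (hP : 0 ≤ P) {c p : ℝ} (hc : 0 ≤ c) (hp : 0 ≤ p) :
    (c • P) ^ p = c ^ p • P ^ p := by
  have hcont : ContinuousOn (fun x : ℝ => x ^ p) (spectrum ℝ P) :=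
    (Real.continuous_rpow_const hp).continuousOn
  rw [CFC.rpow_eq_cfc_real (ha := smul_nonneg hc hP), CFC.rpow_eq_cfc_real (ha := hP),
    ← cfc_comp_smul c (fun x : ℝ => x ^ p) P (Real.continuous_rpow_const hp).continuousOn
      hP.isSelfAdjoint, ← cfc_smul (c ^ p) (fun x : ℝ => x ^ p) P hcont]
  exact cfc_congr fun x hx => Real.mul_rpow hc (spectrum_nonneg_of_nonneg hP hx)

theorem schattenNorm_smul (e : HilbertBasis ι ℂ H) (c : ℂ) (A : H →L[ℂ] H) {p : ℝ} (hp : 0 < p) :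
    schattenNorm e p (c • A) = ‖c‖ₑ * schattenNorm e p A := by
  rw [schattenNorm, CFC.abs_smul, smul_rpow_of_nonneg (CFC.abs_nonneg A) (norm_nonneg c) hp.le,
    posTrace_smul e (Real.rpow_nonneg (norm_nonneg c) p),
    ENNReal.mul_rpow_of_nonneg _ _ (one_div_nonneg.2 hp.le),
    ← ENNReal.ofReal_rpow_of_nonneg (norm_nonneg c) hp.le, one_div,
    ENNReal.rpow_rpow_inv hp.ne', ofReal_norm, schattenNorm, one_div]

theorem schattenNorm_one_of_nonneg (e : HilbertBasis ι ℂ H) {A : H →L[ℂ] H} (hA : 0 ≤ A) :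
    schattenNorm e 1 A = posTrace e A := by
  rw [schattenNorm, CFC.abs_of_nonneg A hA, CFC.rpow_one A hA, one_div_one, ENNReal.rpow_one]

theorem schattenNorm_sum_le {α : Type*} (e : HilbertBasis ι ℂ H) (s : Finset α)
    {C : α → H →L[ℂ] H} (hC : ∀ k, IsCompactOperator (C k)) {p : ℝ} (hp : 1 ≤ p) :
    schattenNorm e p (∑ k ∈ s, C k) ≤ ∑ k ∈ s, schattenNorm e p (C k) := by
  classical
  induction s using Finset.induction_on with
  | empty => simpa using (schattenNorm_smul e 0 0 (one_pos.trans_le hp)).le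
  | insert k s hk ih =>
    rw [Finset.sum_insert hk, Finset.sum_insert hk]
    have hs : IsCompactOperator (∑ k ∈ s, C k : H →L[ℂ] H) :=
      Submodule.sum_mem (compactOperator (RingHom.id ℂ) H H) fun k _ => hC k
    exact (schattenNorm_add_le e (hC k) hs hp).trans (add_le_add_right ih _)

theorem schattenNorm_one_sum_smul_le {α : Type*} (e : HilbertBasis ι ℂ H) (s : Finset α) {a : α → ℂ}
    (ha : ∀ k, ‖a k‖ₑ ≤ 1) {C : α → H →L[ℂ] H} (hC : ∀ k, IsCompactOperator (C k))
    (hpos : ∀ k, 0 ≤ C k) :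
    schattenNorm e 1 (∑ k ∈ s, a k • C k) ≤ posTrace e (∑ k ∈ s, C k) :=
  calc schattenNorm e 1 (∑ k ∈ s, a k • C k)
      ≤ ∑ k ∈ s, schattenNorm e 1 (a k • C k) :=
        schattenNorm_sum_le e s (fun k => (hC k).smul (a k)) le_rfl
    _ ≤ ∑ k ∈ s, posTrace e (C k) := by
        gcongr with k
        rw [schattenNorm_smul e _ _ one_pos, schattenNorm_one_of_nonneg e (hpos k)]
        exact mul_le_of_le_one_left zero_le (ha k)
    _ = posTrace e (∑ k ∈ s, C k) := (posTrace_sum e s fun k _ => hpos k).symm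

end SingularValues

section Measurability

open TopologicalSpace

variable {ι : Type*} {H : Type*} [NormedAddCommGroup H] [InnerProductSpace ℂ H]

theorem countable_of_hilbertBasis [SeparableSpace H] (e : HilbertBasis ι ℂ H) : Countable ι := by
  have hdisjoint : Pairwise (Function.onFun Disjoint fun i => Metric.ball (e i) (1 / 2)) := by
    intro i j hij
    have hsq := norm_sub_sq (𝕜 := ℂ) (e i) (e j)
    rw [e.orthonormal.2 hij, e.orthonormal.1, e.orthonormal.1] at hsq
    norm_num at hsq
    refine Metric.ball_disjoint_ball ?_
    rw [dist_eq_norm]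
    nlinarith [norm_nonneg (e i - e j)]
  exact hdisjoint.countable_of_isOpen_disjoint (fun i => Metric.isOpen_ball)
    (fun i => ⟨e i, Metric.mem_ball_self (by norm_num)⟩)

open scoped ComplexOrder in
theorem nonneg_iff_forall_inner_nonneg [CompleteSpace H] (T : H →L[ℂ] H) :
    0 ≤ T ↔ ∀ v, 0 ≤ ⟪v, T v⟫_ℂ := by
  refine ⟨fun hT => ((ContinuousLinearMap.nonneg_iff_isPositive T).1 hT).inner_nonneg_right,
    fun hT => ?_⟩
  rw [ContinuousLinearMap.nonneg_iff_isPositive, ContinuousLinearMap.isPositive_iff_complex]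
  intro v
  have hv : 0 ≤ ⟪T v, v⟫_ℂ := by
    rw [← inner_conj_symm]
    exact star_nonneg_iff.2 (hT v)
  exact ⟨(Complex.eq_re_of_ofReal_le hv).symm, (Complex.nonneg_iff.1 hv).1⟩

variable {X : Type*} [MeasurableSpace X]

/-- Measurability of an operator-valued function in the sense that all matrix coefficients are
measurable. Quantum random variables have this property, and it survives products and the
continuous functional calculus. -/
def WeaklyMeasurable (F : X → H →L[ℂ] H) : Prop :=
  ∀ u v, Measurable fun x => ⟪u, F x v⟫_ℂ

namespace WeaklyMeasurable

variable {F G : X → H →L[ℂ] H}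

theorem of_inner_self (hF : ∀ v, Measurable fun x => ⟪v, F x v⟫_ℂ) : WeaklyMeasurable F := by
  have hconj (v : H) : Measurable fun x => ⟪F x v, v⟫_ℂ := by
    simp_rw [← inner_conj_symm (F _ v) v]
    exact Complex.continuous_conj.measurable.comp (hF v)
  intro u v
  simp_rw [← inner_conj_symm u (F _ v), ← ContinuousLinearMap.coe_coe (F _),
    inner_map_polarization _ u v]
  exact Complex.continuous_conj.measurable.comp
    (((((hconj _).sub (hconj _)).add ((hconj _).const_mul _)).sub
      ((hconj _).const_mul _)).div_const _)

theorem const (T : H →L[ℂ] H) : WeaklyMeasurable fun _ : X => T :=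
  fun _ _ => measurable_const

theorem add (hF : WeaklyMeasurable F) (hG : WeaklyMeasurable G) :
    WeaklyMeasurable fun x => F x + G x := fun u v => by
  simp only [_root_.add_apply, inner_add_right]
  exact (hF u v).add (hG u v)

theorem smul (c : ℂ) (hF : WeaklyMeasurable F) : WeaklyMeasurable fun x => c • F x :=
  fun u v => by simpa only [_root_.smul_apply, inner_smul_right] using (hF u v).const_mul c

theorem of_tendsto {F : ℕ → X → H →L[ℂ] H} (hF : ∀ n, WeaklyMeasurable (F n))
    (hlim : ∀ x, Tendsto (fun n => F n x) atTop (𝓝 (G x))) : WeaklyMeasurable G := by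
  intro u v
  have hcont : Continuous fun T : H →L[ℂ] H => ⟪u, T v⟫_ℂ := by fun_prop
  exact measurable_of_tendsto_metrizable (fun n => hF n u v)
    (tendsto_pi_nhds.2 fun x => (hcont.tendsto _).comp (hlim x))

theorem posTrace [SeparableSpace H] (e : HilbertBasis ι ℂ H) (hF : WeaklyMeasurable F) :
    Measurable fun x => OpLp.posTrace e (F x) := by
  have := countable_of_hilbertBasis e
  exact Measurable.tsum fun i => (Complex.measurable_re.comp (hF (e i) (e i))).ennreal_ofReal

variable [CompleteSpace H]

theorem star (hF : WeaklyMeasurable F) : WeaklyMeasurable fun x => star (F x) := by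
  intro u v
  simp_rw [ContinuousLinearMap.star_eq_adjoint, ContinuousLinearMap.adjoint_inner_right,
    ← inner_conj_symm (F _ u) v]
  exact Complex.continuous_conj.measurable.comp (hF v u)

variable [SeparableSpace H]

theorem mul (hF : WeaklyMeasurable F) (hG : WeaklyMeasurable G) :
    WeaklyMeasurable fun x => F x * G x := by
  obtain ⟨w, e, -⟩ := exists_hilbertBasis ℂ H
  have := countable_of_hilbertBasis e
  have hexpand (u v : H) (x : X) :
      ⟪u, (F x * G x) v⟫_ℂ = ∑' i, ⟪u, F x (e i)⟫_ℂ * ⟪e i, G x v⟫_ℂ := by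
    simp_rw [← ContinuousLinearMap.adjoint_inner_left (F x), e.tsum_inner_mul_inner,
      ContinuousLinearMap.adjoint_inner_left, mul_apply_eq_comp]
  intro u v
  simp_rw [hexpand]
  exact Measurable.tsum fun i => (hF u (e i)).mul (hG (e i) v)

theorem pow (hF : WeaklyMeasurable F) (n : ℕ) : WeaklyMeasurable fun x => F x ^ n := by
  induction n with
  | zero => simpa only [pow_zero] using const 1
  | succ n ih => simpa only [pow_succ] using ih.mul hF

theorem aeval (hF : WeaklyMeasurable F) (p : ℝ[X]) :
    WeaklyMeasurable fun x => Polynomial.aeval (F x) p := by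
  induction p using Polynomial.induction_on' with
  | add p q hp hq => simpa only [map_add] using hp.add hq
  | monomial n a =>
    simp_rw [aeval_monomial, Algebra.algebraMap_eq_smul_one, smul_mul_assoc, one_mul,
      ← Complex.coe_smul]
    exact (hF.pow n).smul a

theorem cfc (hF : WeaklyMeasurable F) (hsa : ∀ x, IsSelfAdjoint (F x)) {f : ℝ → ℝ}
    (hf : Continuous f) : WeaklyMeasurable fun x => _root_.cfc f (F x) := by
  obtain ⟨P, hP⟩ := exists_polynomial_tendstoLocallyUniformly hf
  exact of_tendsto (fun n => hF.aeval (P n)) fun x => tendsto_aeval_cfc hP (hsa x)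

open scoped ComplexOrder in
theorem measurableSet_nonneg (hF : WeaklyMeasurable F) : MeasurableSet {x | 0 ≤ F x} := by
  have hdense (x : X) : 0 ≤ F x ↔ ∀ n, 0 ≤ ⟪denseSeq H n, F x (denseSeq H n)⟫_ℂ := by
    rw [nonneg_iff_forall_inner_nonneg]
    refine ⟨fun h n => h _, fun h => ?_⟩
    have hclosed : IsClosed {v | 0 ≤ ⟪v, F x v⟫_ℂ} := isClosed_le continuous_const (by fun_prop)
    exact isClosed_property (denseRange_denseSeq H) hclosed h
  simp_rw [hdense, Set.ofPred_forall]
  exact MeasurableSet.iInter fun n => hF _ _ measurableSet_Ici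

open Classical in
theorem ite_nonneg (hF : WeaklyMeasurable F) :
    WeaklyMeasurable fun x => if 0 ≤ F x then F x else 0 := fun u v => by
  simpa only [apply_ite (fun T : H →L[ℂ] H => ⟪u, T v⟫_ℂ)] using
    Measurable.ite hF.measurableSet_nonneg (hF u v) measurable_const

open Classical in
theorem sqrt (hF : WeaklyMeasurable F) : WeaklyMeasurable fun x => CFC.sqrt (F x) := by
  have hnonneg (x : X) : 0 ≤ if 0 ≤ F x then F x else 0 := by
    split_ifs with hx
    exacts [hx, le_rfl]
  have hsqrt (x : X) : CFC.sqrt (F x) = _root_.cfc Real.sqrt (if 0 ≤ F x then F x else 0) := by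
    rw [← cfcₙ_eq_cfc, ← CFC.sqrt_eq_real_sqrt _ (hnonneg x)]
    split_ifs with hx
    · rfl
    · rw [CFC.sqrt_of_not_nonneg hx, CFC.sqrt_zero]
  simp_rw [hsqrt]
  exact hF.ite_nonneg.cfc (fun x => (hnonneg x).isSelfAdjoint) Real.continuous_sqrt

theorem abs (hF : WeaklyMeasurable F) : WeaklyMeasurable fun x => CFC.abs (F x) :=
  (hF.star.mul hF).sqrt

theorem rpow (hF : WeaklyMeasurable F) (hnonneg : ∀ x, 0 ≤ F x) {p : ℝ} (hp : 0 ≤ p) :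
    WeaklyMeasurable fun x => F x ^ p := by
  simp_rw [CFC.rpow_eq_cfc_real (ha := hnonneg _)]
  exact hF.cfc (fun x => (hnonneg x).isSelfAdjoint) (Real.continuous_rpow_const hp)

theorem schattenNorm (e : HilbertBasis ι ℂ H) (hF : WeaklyMeasurable F) {p : ℝ} (hp : 0 ≤ p) :
    Measurable fun x => OpLp.schattenNorm e p (F x) :=
  ((hF.abs.rpow (fun _ => CFC.abs_nonneg _) hp).posTrace e).pow_const _

theorem sqrt_conj_sandwich {D f : X → H →L[ℂ] H} (hD : WeaklyMeasurable D)
    (hf : WeaklyMeasurable f) (s : H →L[ℂ] H) :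
    WeaklyMeasurable fun x => CFC.sqrt s * sandwich D f x * CFC.sqrt s :=
  ((const _).mul ((hD.sqrt.mul hf).mul hD.sqrt)).mul (const _)

end WeaklyMeasurable

theorem rankOne_mem_states (e : HilbertBasis ι ℂ H) {v : H} (hv : ‖v‖ = 1) :
    InnerProductSpace.rankOne ℂ v v ∈ states e := by
  refine ⟨(ContinuousLinearMap.nonneg_iff_isPositive _).2
    (InnerProductSpace.isPositive_rankOne_self v), ?_⟩
  calc posTrace e (InnerProductSpace.rankOne ℂ v v)
      = ∑' i, ‖⟪e i, v⟫_ℂ‖ₑ ^ 2 := tsum_congr fun i => by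
        rw [InnerProductSpace.rankOne_apply, inner_smul_right, ← inner_conj_symm v,
          Complex.conj_mul', ← ofReal_norm, ← ENNReal.ofReal_pow (norm_nonneg _)]
        norm_cast
    _ = 1 := by rw [tsum_enorm_inner_sq, ← ofReal_norm, hv, ENNReal.ofReal_one, one_pow]

variable [CompleteSpace H]

theorem trace_rankOne_mul (e : HilbertBasis ι ℂ H) (v : H) (T : H →L[ℂ] H) :
    trace e (InnerProductSpace.rankOne ℂ v v * T) = ⟪v, T v⟫_ℂ := by
  rw [← ContinuousLinearMap.adjoint_inner_left, ← e.tsum_inner_mul_inner]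
  refine tsum_congr fun i => ?_
  rw [mul_apply_eq_comp, InnerProductSpace.rankOne_apply, inner_smul_right,
    ContinuousLinearMap.adjoint_inner_left]

variable {e : HilbertBasis ι ℂ H} {f : X → H →L[ℂ] H}

theorem IsQuantumRV.weaklyMeasurable (hf : IsQuantumRV e f) : WeaklyMeasurable f := by
  refine .of_inner_self fun v => ?_
  rcases eq_or_ne v 0 with rfl | hv
  · simp
  have hunit := hf _ (rankOne_mem_states e (NormedSpace.norm_normalize hv))
  simp_rw [trace_rankOne_mul] at hunit
  have hscale (x : X) : ⟪v, f x v⟫_ℂ =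
      ‖v‖ • ‖v‖ • ⟪NormedSpace.normalize v, f x (NormedSpace.normalize v)⟫_ℂ := by
    conv_lhs => rw [← NormedSpace.norm_smul_normalize v]
    rw [ContinuousLinearMap.map_smul_of_tower, inner_smul_left_eq_smul, inner_smul_right_eq_smul]
  simp_rw [hscale]
  exact (hunit.const_smul ‖v‖).const_smul ‖v‖

theorem weaklyMeasurable_of_mem_quantumSpan (hf : f ∈ quantumSpan X e) : WeaklyMeasurable f := by
  unfold quantumSpan at hf
  induction hf using Submodule.span_induction with
  | mem f hf => exact hf.1.weaklyMeasurable
  | zero => exact .const 0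
  | add f g _ _ hf hg => exact hf.add hg
  | smul c f _ hf => exact hf.smul c

end Measurability

section OperatorLp

variable {ι : Type*} {H : Type*} [NormedAddCommGroup H] [InnerProductSpace ℂ H] [CompleteSpace H]
variable {X : Type*}

theorem sandwich_smul (D : X → H →L[ℂ] H) (c : ℂ) (f : X → H →L[ℂ] H) (x : X) :
    sandwich D (c • f) x = c • sandwich D f x := by
  simp only [sandwich, Pi.smul_apply, mul_smul_comm, smul_mul_assoc]

theorem sandwich_add (D f g : X → H →L[ℂ] H) (x : X) :
    sandwich D (f + g) x = sandwich D f x + sandwich D g x := by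
  simp only [sandwich, Pi.add_apply, mul_add, add_mul]

theorem sandwich_sum {α : Type*} (D : X → H →L[ℂ] H) (t : Finset α) (g : α → X → H →L[ℂ] H)
    (x : X) : sandwich D (∑ k ∈ t, g k) x = ∑ k ∈ t, sandwich D (g k) x := by
  simp only [sandwich, Finset.sum_apply, Finset.mul_sum, Finset.sum_mul]

theorem sandwich_nonneg (D : X → H →L[ℂ] H) {f : X → H →L[ℂ] H} {x : X} (hf : 0 ≤ f x) :
    0 ≤ sandwich D f x :=
  sqrt_conj_nonneg (D x) hf

theorem schattenNorm_one_sandwich_sum_smul_le {α : Type*} {e : HilbertBasis ι ℂ H}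
    {s : H →L[ℂ] H} (hs : s ∈ states e) (D : X → H →L[ℂ] H) (t : Finset α) {a : α → ℂ}
    (ha : ∀ k, ‖a k‖ₑ ≤ 1) {g : α → X → H →L[ℂ] H} {x : X} (hg : ∀ k, 0 ≤ g k x) :
    schattenNorm e 1 (CFC.sqrt s * sandwich D (∑ k ∈ t, a k • g k) x * CFC.sqrt s) ≤
      ‖stateFun e D s (∑ k ∈ t, g k) x‖ₑ := by
  have hsum : 0 ≤ (∑ k ∈ t, g k) x := by
    rw [Finset.sum_apply]
    exact Finset.sum_nonneg fun k _ => hg k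
  rw [stateFun, enorm_trace_mul_of_nonneg hs (sandwich_nonneg D hsum), sandwich_sum]
  simp_rw [sandwich_sum, sandwich_smul, Finset.mul_sum, Finset.sum_mul, mul_smul_comm,
    smul_mul_assoc]
  exact schattenNorm_one_sum_smul_le e t ha (fun k => isCompactOperator_sqrt_conj hs _)
    fun k => sqrt_conj_nonneg s (sandwich_nonneg D (hg k))

variable [MeasurableSpace X] (e : HilbertBasis ι ℂ H) (μ : Measure X)

theorem schattenLNorm_smul (D f : X → H →L[ℂ] H) (c : ℂ) {p q : ℝ} (hp : 0 < p) (hq : 0 < q) :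
    schattenLNorm e μ D p q (c • f) = ‖c‖ₑ * schattenLNorm e μ D p q f := by
  unfold schattenLNorm
  simp_rw [ENNReal.mul_iSup, sandwich_smul, mul_smul_comm, smul_mul_assoc,
    schattenNorm_smul e c _ hp, ENNReal.mul_rpow_of_nonneg _ _ hq.le,
    lintegral_const_mul' _ _ (ENNReal.rpow_ne_top_of_nonneg hq.le enorm_ne_top),
    ENNReal.mul_rpow_of_nonneg _ _ (one_div_nonneg.2 hq.le), one_div,
    ENNReal.rpow_rpow_inv hq.ne']

theorem schattenLNorm_add_le [TopologicalSpace.SeparableSpace H] {D f g : X → H →L[ℂ] H}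
    (hD : WeaklyMeasurable D) (hf : WeaklyMeasurable f) (hg : WeaklyMeasurable g) {p q : ℝ}
    (hp : 1 ≤ p) (hq : 1 ≤ q) :
    schattenLNorm e μ D p q (f + g) ≤ schattenLNorm e μ D p q f + schattenLNorm e μ D p q g := by
  refine iSup₂_le fun s hs => ?_
  let N (h : X → H →L[ℂ] H) (x : X) : ℝ≥0∞ :=
    schattenNorm e p (CFC.sqrt s * sandwich D h x * CFC.sqrt s)
  have hN {h : X → H →L[ℂ] H} (hh : WeaklyMeasurable h) : AEMeasurable (N h) μ :=
    ((hD.sqrt_conj_sandwich hh s).schattenNorm e (zero_le_one.trans hp)).aemeasurable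
  have hN_add (x : X) : N (f + g) x ≤ N f x + N g x := by
    simp only [N, sandwich_add, mul_add, add_mul]
    exact schattenNorm_add_le e (isCompactOperator_sqrt_conj hs _)
      (isCompactOperator_sqrt_conj hs _) hp
  have hN_le (h : X → H →L[ℂ] H) :
      (∫⁻ x, N h x ^ q ∂μ) ^ (1 / q) ≤ schattenLNorm e μ D p q h :=
    le_iSup₂_of_le s hs le_rfl
  calc (∫⁻ x, N (f + g) x ^ q ∂μ) ^ (1 / q)
      ≤ (∫⁻ x, (N f + N g) x ^ q ∂μ) ^ (1 / q) := by
        gcongr with x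
        exact hN_add x
    _ ≤ (∫⁻ x, N f x ^ q ∂μ) ^ (1 / q) + (∫⁻ x, N g x ^ q ∂μ) ^ (1 / q) :=
        ENNReal.lintegral_Lp_add_le (hN hf) (hN hg) hq
    _ ≤ schattenLNorm e μ D p q f + schattenLNorm e μ D p q g := add_le_add (hN_le f) (hN_le g)

theorem schattenLNorm_anti (D f : X → H →L[ℂ] H) {p r q : ℝ} (hr : 0 < r) (hrp : r ≤ p)
    (hq : 0 < q) : schattenLNorm e μ D p q f ≤ schattenLNorm e μ D r q f := by
  refine iSup₂_mono fun s hs => ?_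
  gcongr with x
  exact schattenNorm_anti e (isCompactOperator_sqrt_conj hs _) hr hrp

theorem schattenLNorm_one_le_qNorm (D f : X → H →L[ℂ] H) {q : ℝ} (hq : 0 < q) :
    schattenLNorm e μ D 1 q f ≤ qNorm e μ D q f := by
  refine le_iInf₂ fun g hg => iSup₂_mono fun s hs => ?_
  let a : Fin 4 → ℂ := ![1, -1, Complex.I, -Complex.I]
  have ha (k : Fin 4) : ‖a k‖ₑ ≤ 1 := by
    fin_cases k <;> simp [a, ← ofReal_norm]
  have hf : f = ∑ k, a k • g k := by
    rw [hg.2, Fin.sum_univ_four]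
    simp [a, sub_eq_add_neg]
  gcongr with x
  rw [hf, ← Fin.sum_univ_four g]
  exact schattenNorm_one_sandwich_sum_smul_le hs D _ ha fun k => (hg.1 k).2 x

theorem isSeminormOn_schattenLNorm [TopologicalSpace.SeparableSpace H] {D : X → H →L[ℂ] H}
    (hD : WeaklyMeasurable D) {p q : ℝ} (hp : 1 ≤ p) (hq : 1 ≤ q) :
    IsSeminormOn (quantumSpan X e) (schattenLNorm e μ D p q) where
  map_zero := by
    simpa using schattenLNorm_smul e μ D 0 0 (zero_lt_one.trans_le hp) (zero_lt_one.trans_le hq)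
  smul c f _ := schattenLNorm_smul e μ D f c (zero_lt_one.trans_le hp) (zero_lt_one.trans_le hq)
  add_le _ hf _ hg := schattenLNorm_add_le e μ hD (weaklyMeasurable_of_mem_quantumSpan hf)
    (weaklyMeasurable_of_mem_quantumSpan hg) hp hq

end OperatorLp

end

end OpLp

theorem mainTheorem11_general
    {H : Type*} [NormedAddCommGroup H] [InnerProductSpace ℂ H] [CompleteSpace H]
    [TopologicalSpace.SeparableSpace H]
    {ι : Type*} (e : HilbertBasis ι ℂ H)
    {X : Type*} [MeasurableSpace X]
    (ν : OpLp.POVM X e) (ρ : H →L[ℂ] H) (hρ : ρ ∈ OpLp.states e)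
    (D : X → H →L[ℂ] H) (hD : OpLp.IsRNDeriv ν hρ D) :
    (∀ p q : ℝ, 1 ≤ p → 1 ≤ q →
      OpLp.IsSeminormOn (OpLp.quantumSpan X e)
        (OpLp.schattenLNorm e (OpLp.scalarMeasure ν hρ) D p q)) ∧
    (∀ p r q : ℝ, 0 < r → r ≤ p → 0 < q → ∀ f ∈ OpLp.quantumSpan X e,
      OpLp.schattenLNorm e (OpLp.scalarMeasure ν hρ) D p q f ≤
        OpLp.schattenLNorm e (OpLp.scalarMeasure ν hρ) D r q f) ∧
    (∀ q : ℝ, 0 < q → ∀ f ∈ OpLp.quantumSpan X e,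
      OpLp.schattenLNorm e (OpLp.scalarMeasure ν hρ) D 1 q f ≤
        OpLp.qNorm e (OpLp.scalarMeasure ν hρ) D q f) :=
  ⟨fun _ _ hp hq => OpLp.isSeminormOn_schattenLNorm e _ hD.isQuantumRV.weaklyMeasurable hp hq,
    fun _ _ _ hr hrp hq f _ => OpLp.schattenLNorm_anti e _ D f hr hrp hq,
    fun _ hq f _ => OpLp.schattenLNorm_one_le_qNorm e _ D f hq⟩

theorem mainTheorem11
    {H : Type*} [NormedAddCommGroup H] [InnerProductSpace ℂ H] [CompleteSpace H]
    [TopologicalSpace.SeparableSpace H]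
    {ι : Type*} (e : HilbertBasis ι ℂ H)
    {X : Type*} [TopologicalSpace X] [LocallyCompactSpace X] [T2Space X]
    [MeasurableSpace X] [BorelSpace X]
    (ν : OpLp.POVM X e)
    (ρ : H →L[ℂ] H) (hρ : ρ ∈ OpLp.states e) (hρ_full : Function.Injective ρ)
    (D : X → H →L[ℂ] H) (hD : OpLp.IsRNDeriv ν hρ D) :
    (∀ p q : ℝ, 1 ≤ p → 1 ≤ q →
      OpLp.IsSeminormOn (OpLp.quantumSpan X e)
        (OpLp.schattenLNorm e (OpLp.scalarMeasure ν hρ) D p q)) ∧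
    (∀ p r q : ℝ, 1 ≤ r → r ≤ p → 1 ≤ q → ∀ f ∈ OpLp.quantumSpan X e,
      OpLp.schattenLNorm e (OpLp.scalarMeasure ν hρ) D p q f ≤
        OpLp.schattenLNorm e (OpLp.scalarMeasure ν hρ) D r q f) ∧
    (∀ q : ℝ, 1 ≤ q → ∀ f ∈ OpLp.quantumSpan X e,
      OpLp.schattenLNorm e (OpLp.scalarMeasure ν hρ) D 1 q f ≤
        OpLp.qNorm e (OpLp.scalarMeasure ν hρ) D q f) := by
  obtain ⟨hseminorm, hanti, hle⟩ := mainTheorem11_general e ν ρ hρ D hD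
  exact ⟨hseminorm, fun p r q hr hrp hq => hanti p r q (zero_lt_one.trans_le hr) hrp
    (zero_lt_one.trans_le hq), fun q hq => hle q (zero_lt_one.trans_le hq)⟩
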